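/- Let $n$ be a natural number and $p$ a prime, and put $d:=\gcd(n,p-1)$ and $t:=(p-1)/d$. Write $\mathbf{e}(u):=\exp(2\pi i u)$ and $$G_d(p):=\max_{\gcd(a,p)=1}\Bigl|\sum_{x \bmod p}\mathbf{e}(ax^d/p)\Bigr|.$$ Let $g$ be a generator of the multiplicative group $\mathbb{F}_p^*$, let $\varphi$ be the Euler function, and for $b\in\mathbb{F}_p$ ($p$ odd) let $\llbracket b\rrbracket_p$ be the unique integer in the residue class $b$ with $-p/2<\llbracket b\rrbracket_p<p/2$. Suppose that $n\ge 2000$, $\varphi(t)\ge 10$, $p\ge 8000$, and $$\sum_{x=1}^{t}\llbracket g^{dx+y}\rrbracket_p^2\ \ge\ 13\,p^{16/9}t^{1/9}\qquad(1\le y\le d).$$ Then $G_d(p)\le p^{1-1/n}$. -/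

import Mathlib

namespace Stechkin

/-- The additive character `e(t) = exp(2πit)`. -/
noncomputable def e (t : ℝ) : ℂ := Complex.exp (2 * Real.pi * Complex.I * t)

/-- The Gauss sum `S_n(a,q) = ∑_{x mod q} e(a xⁿ / q)`. -/
noncomputable def S (n : ℕ) (a : ℤ) (q : ℕ) : ℂ :=
  ∑ x ∈ Finset.range q, e ((a : ℝ) * (x : ℝ) ^ n / (q : ℝ))

/-- The absolute values of the sums `S_n(a,q)` with `gcd(a,q) = 1`. -/
def absValues (n q : ℕ) : Set ℝ := {r | ∃ a : ℤ, Int.gcd a q = 1 ∧ r = ‖S n a q‖}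

/-- `G_n(q) = max_{gcd(a,q)=1} |S_n(a,q)|`; the maximum is attained, see `isGreatest_G`. -/
noncomputable def G (n q : ℕ) : ℝ := sSup (absValues n q)

theorem S_emod (n : ℕ) (a : ℤ) (q : ℕ) (hq : q ≠ 0) : S n (a % q) q = S n a q := by
  unfold S e
  refine Finset.sum_congr rfl fun x _ => ?_
  rw [Complex.exp_eq_exp_iff_exists_int]
  refine ⟨-((a / q) * (x : ℤ) ^ n), ?_⟩
  have h : (a : ℂ) = ((a % q : ℤ) : ℂ) + (q : ℂ) * ((a / q : ℤ) : ℂ) := by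
    exact_mod_cast (Int.emod_add_mul_ediv a q).symm
  have hq' : (q : ℂ) ≠ 0 := by exact_mod_cast hq
  push_cast
  rw [h]
  field_simp
  ring

/-- The supremum defining `G n q` is a maximum for every modulus `q ≥ 1`. -/
theorem isGreatest_G (n q : ℕ) (hq : q ≠ 0) : IsGreatest (absValues n q) (G n q) := by
  have hfin : (absValues n q).Finite := by
    refine ((Set.finite_Ico (0 : ℤ) q).image fun a => ‖S n a q‖).subset ?_
    rintro r ⟨a, -, rfl⟩
    refine ⟨a % q, ⟨Int.emod_nonneg _ (by exact_mod_cast hq),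
      Int.emod_lt_of_pos _ (by positivity)⟩, ?_⟩
    simp only [S_emod n a q hq]
  have hne : (absValues n q).Nonempty := ⟨_, 1, by simp, rfl⟩
  exact ⟨hne.csSup_mem hfin, fun r hr => le_csSup hfin.bddAbove hr⟩

/-- For odd `p` and a residue class `b` mod `p`, the unique integer in the class `b`
with `-p/2 < bracket b < p/2`. -/
def bracket {p : ℕ} (b : ZMod p) : ℤ := b.valMinAbs

theorem bracket_eq_iff {p : ℕ} [NeZero p] (hp : Odd p) (b : ZMod p) (m : ℤ) :
    bracket b = m ↔ (b = (m : ZMod p) ∧ -(p : ℝ) / 2 < m ∧ (m : ℝ) < p / 2) := by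
  have h1 : -(p : ℝ) / 2 < m ↔ -(p : ℤ) < m * 2 := by
    rw [div_lt_iff₀ (by norm_num)]
    exact_mod_cast Iff.rfl
  have h2 : (m : ℝ) < p / 2 ↔ m * 2 < p := by
    rw [lt_div_iff₀ (by norm_num)]
    exact_mod_cast Iff.rfl
  rw [h1, h2, bracket, ZMod.valMinAbs_spec, Set.mem_Ioc]
  obtain ⟨k, hk⟩ := hp
  have : m * 2 ≤ p ↔ m * 2 < p := by omega
  rw [this]

end Stechkin

namespace Stechkin

/-! ### Stepanov's method for additive shifts of groups of roots of unity -/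

section Stepanov

open Polynomial

variable {K : Type*} [Field K]

/-! Let `H` be the group of `t`-th roots of unity mod `p`. Since `x ↦ x ^ d` is `d`-to-one from the
nonzero residues onto `H`, the Gauss sum is `1 + d * groupSum t a` (`S_eq_groupSum`). With `T =
‖groupSum t a‖`, outside one easy case it suffices that `1 + d * T ≤ p - p * log p / n`, because `p
^ (1 - 1/n) = p * exp (-log p / n)`. Since `d ≤ n`, a large `d` forces `n` to be large.

The source of the bound on `T` depends on `t`. For `t ≥ 2 p ^ (1/2)`, Parseval gives `T ≤ p ^
(1/2)`; if moreover `d ≤ p ^ (1/4)`, then `d * T ≤ p ^ (3/4)` suffices by itself, which is the easy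
case. For `3 p ^ (3/8) ≤ t ≤ 2 p ^ (1/2)`, `T ^ 8 ≤ p * E ^ 2` with `E` the additive energy of `H`,
and Stepanov's method (`diffCount_le`) bounds `E` by a constant times `t ^ (8/3)`, so that `T ≤ 0.95
t`.

For `t ≤ 3 p ^ (3/8)` the hypothesis on least residues enters. As `cos` lies below a parabola, it
keeps the real part of every nontrivial group sum below `t - Δ`, and `norm_groupSum_sq_le_of_re_le`
turns this into a saving in `T`. -/

theorem pow_dvd_derivative_of_pow_succ_dvd {F : K[X]} {r : K} {N : ℕ}
    (h : (X - C r) ^ (N + 1) ∣ F) : (X - C r) ^ N ∣ derivative F := by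
  simpa using pow_sub_one_dvd_derivative_of_pow_dvd h

/-- A polynomial of degree less than the characteristic that has at most `N` terms is not divisible
by `(X - r) ^ N` for `r ≠ 0`, unless it vanishes. -/
theorem eq_zero_of_pow_card_support_dvd (p : ℕ) [Fact p.Prime] [CharP K p] {r : K} (hr : r ≠ 0)
    (N : ℕ) (F : K[X]) (hcard : F.support.card ≤ N) (hdeg : ∀ i ∈ F.support, i < p)
    (hdvd : (X - C r) ^ N ∣ F) : F = 0 := by
  induction N generalizing F with
  | zero => simpa using hcard
  | succ N ih =>
    by_contra hF
    obtain ⟨m, hm⟩ := Polynomial.nonempty_support_iff.2 hF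
    -- This combination removes the term of degree `m` and costs only one order of vanishing at `r`;
    -- degrees below `p` keep distinct exponents distinct in `K`.
    set Q : K[X] := X * derivative F - C (m : K) * F with hQ
    have hcoeff : ∀ i, Q.coeff i = ((i : K) - m) * F.coeff i := by
      intro i
      rcases i with _ | i
      · simp [hQ]
      · simp only [hQ, coeff_sub, coeff_X_mul, coeff_derivative, coeff_C_mul]
        push_cast
        ring
    have hsupp : Q.support ⊆ F.support.erase m := by
      intro i hi
      rw [mem_support_iff, hcoeff] at hi
      refine Finset.mem_erase.2 ⟨?_, mem_support_iff.2 (right_ne_zero_of_mul hi)⟩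
      rintro rfl
      simp at hi
    have hQ0 : Q = 0 := by
      refine ih Q ?_ (fun i hi => hdeg i (Finset.mem_of_mem_erase (hsupp hi))) ?_
      · refine (Finset.card_le_card hsupp).trans ?_
        rw [Finset.card_erase_of_mem hm]
        omega
      · exact dvd_sub ((pow_dvd_derivative_of_pow_succ_dvd hdvd).mul_left _)
          (((pow_dvd_pow _ (Nat.le_succ N)).trans hdvd).mul_left _)
    have hmono : F = monomial m (F.coeff m) := by
      ext i
      rw [coeff_monomial]
      split_ifs with hmi
      · rw [hmi]
      · by_contra hi
        have h := hcoeff i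
        rw [hQ0, coeff_zero, eq_comm, mul_eq_zero, or_iff_left hi, sub_eq_zero] at h
        have := CharP.natCast_injOn_Iio K p (hdeg i (mem_support_iff.2 hi)) (hdeg m hm) h
        exact hmi this.symm
    have hroot : F.eval r = 0 :=
      dvd_iff_isRoot.1 ((dvd_pow_self _ (Nat.succ_ne_zero N)).trans hdvd)
    rw [hmono, eval_monomial] at hroot
    exact (mul_ne_zero (mem_support_iff.1 hm) (pow_ne_zero m hr)) hroot

/-- Modulo `Y` only `F 0` survives, so it vanishes; cancel `Y` and repeat. -/
theorem eq_zero_of_sum_mul_pow_eq_zero {Y : K[X]} (hY : Y ≠ 0) (n : ℕ) (F : ℕ → K[X])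
    (hF : ∀ c, Y ∣ F c → F c = 0) (hsum : ∑ c ∈ Finset.range n, F c * Y ^ c = 0) :
    ∀ c < n, F c = 0 := by
  induction n generalizing F with
  | zero => simp
  | succ n ih =>
    rw [Finset.sum_range_succ'] at hsum
    have hfac : ∑ c ∈ Finset.range n, F (c + 1) * Y ^ (c + 1)
        = Y * ∑ c ∈ Finset.range n, F (c + 1) * Y ^ c := by
      rw [Finset.mul_sum]
      exact Finset.sum_congr rfl fun c _ => by ring
    rw [hfac, pow_zero, mul_one] at hsum
    have h0 : F 0 = 0 := hF 0 ⟨-_, by rw [mul_neg]; exact eq_neg_of_add_eq_zero_right hsum⟩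
    rw [h0, add_zero, mul_eq_zero, or_iff_right hY] at hsum
    intro c hc
    rcases c with _ | c
    · exact h0
    · exact ih (fun c => F (c + 1)) (fun c => hF _) hsum c (by omega)

/-- The derivation `W d/dX`. -/
noncomputable def weightedDerivative (W : K[X]) (P : K[X]) : K[X] := W * derivative P

/-- Where `W` does not vanish, each application lowers the order of vanishing by exactly one, as the
factors `1, ..., j` are nonzero in characteristic `p > j`. -/
theorem iterate_weightedDerivative_eval_ne_zero (p : ℕ) [Fact p.Prime] [CharP K p] {W : K[X]}
    {x : K} (hW : W.eval x ≠ 0) (j : ℕ) (hj : j < p) (U : K[X]) (hU : U.eval x ≠ 0) :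
    (((weightedDerivative W)^[j]) ((X - C x) ^ j * U)).eval x ≠ 0 := by
  induction j generalizing U with
  | zero => simpa using hU
  | succ j ih =>
    rw [Function.iterate_succ_apply]
    have h : weightedDerivative W ((X - C x) ^ (j + 1) * U)
        = (X - C x) ^ j * (C ((j + 1 : ℕ) : K) * W * U + (X - C x) * W * derivative U) := by
      simp only [weightedDerivative, derivative_mul, derivative_X_sub_C_pow]
      simp
      ring
    rw [h]
    refine ih (by omega) _ ?_
    have : ((j + 1 : ℕ) : K) ≠ 0 := by
      rw [Ne, CharP.cast_eq_zero_iff K p]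
      exact Nat.not_dvd_of_pos_of_lt (Nat.succ_pos j) hj
    simpa using ⟨⟨by exact_mod_cast this, hW⟩, hU⟩

theorem pow_dvd_of_iterate_weightedDerivative_eval (p : ℕ) [Fact p.Prime] [CharP K p] {W P : K[X]}
    {x : K} (hW : W.eval x ≠ 0) {D : ℕ} (hD : D ≤ p)
    (h : ∀ k < D, (((weightedDerivative W)^[k]) P).eval x = 0) : (X - C x) ^ D ∣ P := by
  by_cases hP : P = 0
  · simp [hP]
  obtain ⟨U, hPU, hU⟩ := exists_eq_pow_rootMultiplicity_mul_and_not_dvd P hP x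
  by_contra hcon
  have hlt : P.rootMultiplicity x < D := by
    by_contra hge
    exact hcon ((pow_dvd_pow _ (not_lt.1 hge)).trans (pow_rootMultiplicity_dvd P x))
  refine iterate_weightedDerivative_eval_ne_zero p hW _ (hlt.trans_le hD) U
    (fun h0 => hU (dvd_iff_isRoot.2 h0)) ?_
  rw [← hPU]
  exact h _ hlt

/-- The operator conjugate to `X (X - r) d/dX` by multiplication with `X ^ u * (X - r) ^ v`. -/
noncomputable def twistedDerivative (r : K) (u v : ℕ) (Q : K[X]) : K[X] :=
  X * (X - C r) * derivative Q + (C (u : K) * (X - C r) + C (v : K) * X) * Q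

/-- The weight `X * (X - r)` restores the powers lost in differentiating, so the high powers stay a
common factor, to be evaluated as `1` on the roots of unity. -/
theorem weightedDerivative_mul_pow (r : K) (u v : ℕ) (Q : K[X]) :
    weightedDerivative (X * (X - C r)) (Q * (X ^ u * (X - C r) ^ v))
      = twistedDerivative r u v Q * (X ^ u * (X - C r) ^ v) := by
  have hpow : ∀ (Y : K[X]) (n : ℕ), Y * ((n : K[X]) * Y ^ (n - 1)) = n * Y ^ n := by
    intro Y n
    rcases n with _ | n
    · simp
    · rw [Nat.add_sub_cancel]; ring
  have hu := hpow X u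
  have hv := hpow (X - C r) v
  simp only [weightedDerivative, twistedDerivative, derivative_mul, derivative_X_sub_C_pow,
    derivative_X_pow, map_natCast]
  linear_combination Q * (X - C r) ^ (v + 1) * hu + Q * X ^ (u + 1) * hv

theorem iterate_weightedDerivative_mul_pow (r : K) (u v k : ℕ) (Q : K[X]) :
    ((weightedDerivative (X * (X - C r)))^[k]) (Q * (X ^ u * (X - C r) ^ v))
      = ((twistedDerivative r u v)^[k]) Q * (X ^ u * (X - C r) ^ v) := by
  induction k generalizing Q with
  | zero => rfl
  | succ k ih => rw [Function.iterate_succ_apply, weightedDerivative_mul_pow, ih,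
      Function.iterate_succ_apply]

/-- The growth does not depend on `u` and `v`, which keeps the number of linear conditions in
Stepanov's method small. -/
theorem natDegree_iterate_twistedDerivative_le (r : K) (u v k : ℕ) (Q : K[X]) :
    (((twistedDerivative r u v)^[k]) Q).natDegree ≤ Q.natDegree + k := by
  induction k generalizing Q with
  | zero => simp
  | succ k ih =>
    rw [Function.iterate_succ_apply]
    refine (ih _).trans ?_
    suffices h : (twistedDerivative r u v Q).natDegree ≤ Q.natDegree + 1 by omega
    rw [twistedDerivative]
    refine natDegree_add_le_of_degree_le ?_ ?_
    · by_cases hQ : Q.natDegree = 0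
      · rw [derivative_of_natDegree_zero hQ]; simp
      · have h1 := natDegree_derivative_le Q
        refine (natDegree_mul_le_of_le (m := 2) (n := Q.natDegree - 1) ?_ h1).trans (by omega)
        exact natDegree_mul_le_of_le natDegree_X_le (natDegree_X_sub_C_le r)
    · rw [add_comm Q.natDegree]
      refine natDegree_mul_le_of_le (m := 1) (n := Q.natDegree) ?_ le_rfl
      refine natDegree_add_le_of_degree_le ?_ ?_
      · exact (natDegree_C_mul_le _ _).trans (natDegree_X_sub_C_le r)
      · exact (natDegree_C_mul_le _ _).trans natDegree_X_le

theorem iterate_weightedDerivative_sum {ι : Type*} (W : K[X]) (s : Finset ι) (f : ι → K)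
    (P : ι → K[X]) (k : ℕ) :
    ((weightedDerivative W)^[k]) (∑ i ∈ s, C (f i) * P i)
      = ∑ i ∈ s, C (f i) * ((weightedDerivative W)^[k]) (P i) := by
  induction k generalizing P with
  | zero => rfl
  | succ k ih =>
    rw [Function.iterate_succ_apply]
    have : weightedDerivative W (∑ i ∈ s, C (f i) * P i)
        = ∑ i ∈ s, C (f i) * weightedDerivative W (P i) := by
      simp only [weightedDerivative, derivative_sum, derivative_C_mul, Finset.mul_sum]
      exact Finset.sum_congr rfl fun i _ => by ring
    rw [this, ih]
    rfl

/-- The polynomials `X ^ a * X ^ (b * t) * (X - r) ^ (c * t)` with `a < A` and `b, c < B` are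
linearly independent when `A * B ≤ t` and `B * t ≤ p`. -/
theorem sum_stepanov_ne_zero (p : ℕ) [Fact p.Prime] [CharP K p] {r : K} (hr : r ≠ 0)
    {A B t : ℕ} (hAB : A * B ≤ t) (hBt : B * t ≤ p) (f : Fin A × Fin B × Fin B → K) (hf : f ≠ 0) :
    ∑ i, C (f i) * (X ^ (i.1 : ℕ) * (X ^ (i.2.1 * t : ℕ) * (X - C r) ^ (i.2.2 * t : ℕ))) ≠ 0 := by
  intro hsum
  apply hf
  let F : ℕ → K[X] := fun c => if hc : c < B then
    ∑ j : Fin A × Fin B, monomial (j.1 + j.2 * t : ℕ) (f (j.1, j.2, ⟨c, hc⟩)) else 0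
  have hA : A ≤ t ∨ B = 0 := by
    rcases Nat.eq_zero_or_pos B with h | h
    · exact Or.inr h
    · exact Or.inl ((Nat.le_mul_of_pos_right A h).trans hAB)
  have hcoeff : ∀ (c : Fin B) (j : Fin A × Fin B),
      (F c).coeff (j.1 + j.2 * t) = f (j.1, j.2, c) := by
    intro c j
    have hAt : A ≤ t := hA.resolve_right (by have := c.2; omega)
    simp only [F, c.2, dif_pos, finsetSum_coeff, coeff_monomial]
    rw [Finset.sum_eq_single j]
    · simp
    · intro j' _ hj'
      rw [if_neg]
      intro h
      apply hj'
      have h1 := j.1.2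
      have h2 := j'.1.2
      have e1 : (j'.1 : ℕ) = j.1 := by
        have := congrArg (· % t) h
        simpa [Nat.mod_eq_of_lt (h1.trans_le hAt), Nat.mod_eq_of_lt (h2.trans_le hAt)] using this
      have e2 : (j'.2 : ℕ) = j.2 := by
        rw [e1, add_right_inj] at h
        exact Nat.eq_of_mul_eq_mul_right (by omega) h
      exact Prod.ext (Fin.ext e1) (Fin.ext e2)
    · simp
  have hsupp : ∀ c, (F c).support ⊆
      Finset.univ.image (fun j : Fin A × Fin B => (j.1 + j.2 * t : ℕ)) := by
    intro c
    by_cases hc : c < B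
    · intro m hm
      by_contra hcon
      refine mem_support_iff.1 hm ?_
      simp only [F, hc, dif_pos, finsetSum_coeff, coeff_monomial]
      exact Finset.sum_eq_zero fun j _ =>
        if_neg fun h => hcon (Finset.mem_image.2 ⟨j, Finset.mem_univ _, h⟩)
    · simp [F, hc]
  -- `F c` has at most `A * B ≤ t` terms, of degree below `B * t ≤ p`, so it is too sparse to be
  -- divisible by `(X - r) ^ t` unless it is zero.
  have hzero : ∀ c < B, F c = 0 := by
    refine eq_zero_of_sum_mul_pow_eq_zero (Y := (X - C r) ^ t) (pow_ne_zero _ (X_sub_C_ne_zero r))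
      B F ?_ ?_
    · intro c hdvd
      refine eq_zero_of_pow_card_support_dvd p hr t (F c) ?_ ?_ hdvd
      · refine (Finset.card_le_card (hsupp c)).trans (Finset.card_image_le.trans ?_)
        simpa using hAB
      · intro i hi
        obtain ⟨j, -, rfl⟩ := Finset.mem_image.1 (hsupp c hi)
        have h1 := j.1.2
        have h2 := j.2.2
        have hAt : A ≤ t := hA.resolve_right (by omega)
        have h3 : ((j.2 : ℕ) + 1) * t ≤ B * t := Nat.mul_le_mul_right t h2
        rw [add_mul] at h3
        omega
    · rw [← hsum, Finset.sum_range, Fintype.sum_prod_type]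
      simp only [Fintype.sum_prod_type, F, Fin.is_lt, dif_pos, Finset.sum_mul, Fin.eta]
      rw [Finset.sum_comm]
      refine Finset.sum_congr rfl fun a _ => ?_
      rw [Finset.sum_comm]
      refine Finset.sum_congr rfl fun b _ => Finset.sum_congr rfl fun c _ => ?_
      rw [← C_mul_X_pow_eq_monomial, ← pow_mul, mul_comm t]
      ring
  funext i
  rw [Pi.zero_apply, ← hcoeff i.2.2 (i.1, i.2.1), hzero _ i.2.2.2, coeff_zero]

/-- Stepanov's method for the intersection of `{x | x ^ t = 1}` with its shift by `r ≠ 0`. -/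
theorem mul_card_le_of_pow_eq_one (p : ℕ) [Fact p.Prime] [CharP K p] {r : K} (hr : r ≠ 0)
    {A B t : ℕ} (ht : 0 < t) (hB : 2 * A ≤ B ^ 2) (hA : 0 < A) (hAB : A * B ≤ t) (hBt : B * t ≤ p)
    (R : Finset K) (hR : ∀ x ∈ R, x ^ t = 1 ∧ (x - r) ^ t = 1) :
    A * R.card ≤ A - 1 + 2 * ((B - 1) * t) := by
  have hB0 : 0 < B := by
    rcases Nat.eq_zero_or_pos B with h | h
    · subst h; omega
    · exact h
  -- The conditions say that the first `A` derivatives vanish once `X ^ t` and `(X - r) ^ t` are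
  -- replaced by `1`. Each is a polynomial of degree at most `2A - 2`, and `A * (2A - 1) < A * B ^
  -- 2` leaves a nonzero solution.
  let Φ : (Fin A × Fin B × Fin B → K) →ₗ[K] (Fin A × Fin (2 * A - 1) → K) :=
    { toFun := fun f i => ∑ j, f j *
        (((twistedDerivative r (j.2.1 * t) (j.2.2 * t))^[(i.1 : ℕ)]) (X ^ (j.1 : ℕ))).coeff i.2
      map_add' := fun f g => by
        funext i
        simp [add_mul, Finset.sum_add_distrib]
      map_smul' := fun c f => by
        funext i
        simp [Finset.mul_sum, mul_assoc] }
  have hker : LinearMap.ker Φ ≠ ⊥ := by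
    apply LinearMap.ker_ne_bot_of_finrank_lt
    simp only [Module.finrank_fintype_fun_eq_card, Fintype.card_prod, Fintype.card_fin]
    refine Nat.mul_lt_mul_of_pos_left ?_ hA
    rw [← sq]
    omega
  obtain ⟨f, hfmem, hf⟩ := Submodule.exists_mem_ne_zero_of_ne_bot hker
  set P : K[X] := ∑ i, C (f i) * (X ^ (i.1 : ℕ) *
    (X ^ (i.2.1 * t : ℕ) * (X - C r) ^ (i.2.2 * t : ℕ))) with hPdef
  have hP : P ≠ 0 := sum_stepanov_ne_zero p hr hAB hBt f hf
  have hAp : A ≤ p := by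
    calc A ≤ A * B := Nat.le_mul_of_pos_right A hB0
      _ ≤ t := hAB
      _ ≤ B * t := Nat.le_mul_of_pos_left t hB0
      _ ≤ p := hBt
  have hvan : ∀ k < A, ∑ j, C (f j) *
      ((twistedDerivative r (j.2.1 * t) (j.2.2 * t))^[k]) (X ^ (j.1 : ℕ)) = 0 := by
    intro k hk
    ext m
    rw [coeff_zero, finsetSum_coeff]
    simp only [coeff_C_mul]
    by_cases hm : m < 2 * A - 1
    · exact congrFun (LinearMap.mem_ker.1 hfmem) (⟨k, hk⟩, ⟨m, hm⟩)
    · refine Finset.sum_eq_zero fun j _ => ?_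
      rw [coeff_eq_zero_of_natDegree_lt, mul_zero]
      have h1 := natDegree_iterate_twistedDerivative_le r (j.2.1 * t) (j.2.2 * t) k (X ^ (j.1 : ℕ))
      rw [natDegree_X_pow] at h1
      have := j.1.2
      omega
  have hmult : ∀ x ∈ R, (X - C x) ^ A ∣ P := by
    intro x hx
    obtain ⟨hx1, hx2⟩ := hR x hx
    refine pow_dvd_of_iterate_weightedDerivative_eval p (W := X * (X - C r)) ?_ hAp ?_
    · have h1 : x ≠ 0 := by rintro rfl; simp [ht.ne'] at hx1
      have h2 : x - r ≠ 0 := by intro h; simp [h, ht.ne'] at hx2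
      simpa using ⟨h1, h2⟩
    · intro k hk
      rw [hPdef, iterate_weightedDerivative_sum]
      simp only [iterate_weightedDerivative_mul_pow]
      have h := congrArg (eval x) (hvan k hk)
      rw [eval_finsetSum, eval_zero] at h
      rw [eval_finsetSum, ← h]
      refine Finset.sum_congr rfl fun j _ => ?_
      simp [mul_comm _ t, pow_mul, hx1, hx2]
  have hprod : ∏ x ∈ R, (X - C x) ^ A ∣ P := by
    refine Finset.prod_dvd_of_coprime ?_ hmult
    intro x _ y _ hxy
    exact (isCoprime_X_sub_C_of_isUnit_sub (sub_ne_zero.2 hxy).isUnit).pow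
  have hdegP : P.natDegree ≤ A - 1 + 2 * ((B - 1) * t) := by
    refine natDegree_sum_le_of_forall_le _ _ fun i _ => ?_
    refine (natDegree_C_mul_le _ _).trans ?_
    refine (natDegree_mul_le_of_le (m := A - 1) (n := 2 * ((B - 1) * t)) ?_ ?_)
    · rw [natDegree_X_pow]; have := i.1.2; omega
    · rw [two_mul]
      refine natDegree_mul_le_of_le ?_ ?_
      · rw [natDegree_X_pow]
        exact Nat.mul_le_mul_right t (by have := i.2.1.2; omega)
      · rw [natDegree_pow, natDegree_X_sub_C, mul_one]
        exact Nat.mul_le_mul_right t (by have := i.2.2.2; omega)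
  have h := natDegree_le_of_dvd hprod hP
  rw [natDegree_prod _ _ fun x _ => pow_ne_zero _ (X_sub_C_ne_zero x)] at h
  simp only [natDegree_pow, natDegree_X_sub_C, mul_one, Finset.sum_const, smul_eq_mul] at h
  rw [mul_comm]
  exact h.trans hdegP

end Stepanov

/-! ### Sums over the group of roots of unity, their moments and the additive energy -/

section CharacterSums

variable {p : ℕ} [Fact p.Prime]

/-- The group of `t`-th roots of unity in `ZMod p`, as a finite set. -/
def unityRoots (p t : ℕ) [Fact p.Prime] : Finset (ZMod p) :=
  Finset.univ.filter fun x => x ^ t = 1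

theorem mem_unityRoots {t : ℕ} {x : ZMod p} : x ∈ unityRoots p t ↔ x ^ t = 1 := by
  simp [unityRoots]

theorem ne_zero_of_mem_unityRoots {t : ℕ} (ht : 0 < t) {x : ZMod p} (hx : x ∈ unityRoots p t) :
    x ≠ 0 := by
  rintro rfl
  simp [mem_unityRoots, ht.ne'] at hx

theorem sum_unityRoots_mul {M : Type*} [AddCommMonoid M] {t : ℕ} (ht : 0 < t) {h : ZMod p}
    (hh : h ∈ unityRoots p t) (f : ZMod p → M) :
    ∑ x ∈ unityRoots p t, f (h * x) = ∑ x ∈ unityRoots p t, f x := by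
  have h0 := ne_zero_of_mem_unityRoots ht hh
  rw [mem_unityRoots] at hh
  refine Finset.sum_bij' (fun x _ => h * x) (fun x _ => h⁻¹ * x) ?_ ?_ ?_ ?_ ?_
  · intro x hx
    rw [mem_unityRoots] at hx ⊢
    rw [mul_pow, hh, hx, one_mul]
  · intro x hx
    rw [mem_unityRoots] at hx ⊢
    rw [mul_pow, inv_pow, hh, hx, inv_one, one_mul]
  · intro x _
    exact inv_mul_cancel_left₀ h0 x
  · intro x _
    exact mul_inv_cancel_left₀ h0 x
  · intro x _
    rfl

/-- The trigonometric sum over the group of `t`-th roots of unity. -/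
noncomputable def groupSum (t : ℕ) (b : ZMod p) : ℂ :=
  ∑ x ∈ unityRoots p t, ZMod.stdAddChar (b * x)

theorem groupSum_mul {t : ℕ} (ht : 0 < t) {h : ZMod p} (hh : h ∈ unityRoots p t) (b : ZMod p) :
    groupSum t (b * h) = groupSum t b := by
  unfold groupSum
  rw [← sum_unityRoots_mul ht hh fun x => ZMod.stdAddChar (b * x)]
  simp only [mul_assoc]

/-- The number of representations of `l` as a difference of two `t`-th roots of unity. -/
def diffCount (t : ℕ) (l : ZMod p) : ℕ :=
  ((unityRoots p t).filter fun x => x - l ∈ unityRoots p t).card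

theorem sum_sum_unityRoots_sub {M : Type*} [AddCommMonoid M] (t : ℕ) (f : ZMod p → M) :
    ∑ x ∈ unityRoots p t, ∑ y ∈ unityRoots p t, f (x - y)
      = ∑ l : ZMod p, diffCount t l • f l := by
  have h : ∀ x : ZMod p, ∑ y ∈ unityRoots p t, f (x - y)
      = ∑ l : ZMod p, if x - l ∈ unityRoots p t then f l else 0 := by
    intro x
    rw [← Finset.sum_filter]
    refine Finset.sum_bij' (fun y _ => x - y) (fun l _ => x - l) ?_ ?_ ?_ ?_ ?_ <;> simp
  simp only [h]
  rw [Finset.sum_comm]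
  refine Finset.sum_congr rfl fun l _ => ?_
  rw [← Finset.sum_filter, Finset.sum_const, diffCount]

theorem diffCount_zero (t : ℕ) : diffCount t (0 : ZMod p) = (unityRoots p t).card := by
  simp [diffCount]

theorem sum_diffCount (t : ℕ) :
    ∑ l : ZMod p, diffCount t l = (unityRoots p t).card ^ 2 := by
  have h := sum_sum_unityRoots_sub (p := p) t fun _ => 1
  simpa [sq] using h.symm

theorem norm_sq_groupSum (t : ℕ) (b : ZMod p) :
    ((‖groupSum t b‖ ^ 2 : ℝ) : ℂ) = ∑ l : ZMod p, (diffCount t l : ℂ) * ZMod.stdAddChar (b * l) := by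
  have h := sum_sum_unityRoots_sub t fun l : ZMod p => (ZMod.stdAddChar (b * l) : ℂ)
  simp only [nsmul_eq_mul] at h
  rw [← h, Complex.ofReal_pow, ← Complex.mul_conj', groupSum, map_sum, Finset.sum_mul_sum]
  refine Finset.sum_congr rfl fun x _ => Finset.sum_congr rfl fun y _ => ?_
  rw [mul_sub, sub_eq_add_neg, AddChar.map_add_eq_mul, AddChar.map_neg_eq_conj]

theorem parseval (f : ZMod p → ℝ) :
    ∑ b : ZMod p, ‖∑ l : ZMod p, (f l : ℂ) * ZMod.stdAddChar (b * l)‖ ^ 2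
      = p * ∑ l : ZMod p, f l ^ 2 := by
  have key : ∀ b : ZMod p, ((‖∑ l : ZMod p, (f l : ℂ) * ZMod.stdAddChar (b * l)‖ ^ 2 : ℝ) : ℂ)
      = ∑ l : ZMod p, ∑ m : ZMod p, (f l : ℂ) * f m * ZMod.stdAddChar (b * (l - m)) := by
    intro b
    rw [Complex.ofReal_pow, ← Complex.mul_conj', map_sum, Finset.sum_mul_sum]
    refine Finset.sum_congr rfl fun x _ => Finset.sum_congr rfl fun y _ => ?_
    rw [mul_sub, sub_eq_add_neg, AddChar.map_add_eq_mul, AddChar.map_neg_eq_conj,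
      map_mul (starRingEnd ℂ), Complex.conj_ofReal]
    ring
  have h : ((∑ b : ZMod p, ‖∑ l : ZMod p, (f l : ℂ) * ZMod.stdAddChar (b * l)‖ ^ 2 : ℝ) : ℂ)
      = ((p * ∑ l : ZMod p, f l ^ 2 : ℝ) : ℂ) := by
    rw [Complex.ofReal_sum]
    simp only [key]
    rw [Finset.sum_comm]
    push_cast
    rw [Finset.mul_sum]
    refine Finset.sum_congr rfl fun l _ => ?_
    rw [Finset.sum_comm]
    simp only [← Finset.mul_sum, AddChar.sum_mulShift _ (ZMod.isPrimitive_stdAddChar p), sub_eq_zero]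
    rw [Finset.sum_eq_single l]
    · simp [ZMod.card]; ring
    · intro m _ hm
      simp [hm.symm]
    · simp
  exact_mod_cast h

theorem sum_norm_sq_groupSum (t : ℕ) :
    ∑ b : ZMod p, ‖groupSum t b‖ ^ 2 = p * (unityRoots p t).card := by
  have h := parseval (p := p) fun l => if l ∈ unityRoots p t then 1 else 0
  simpa [groupSum, ite_mul, apply_ite (Complex.ofReal)] using h

theorem sum_norm_pow_four_groupSum (t : ℕ) :
    ∑ b : ZMod p, ‖groupSum t b‖ ^ 4 = p * ∑ l : ZMod p, (diffCount t l : ℝ) ^ 2 := by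
  rw [← parseval]
  refine Finset.sum_congr rfl fun b _ => ?_
  simp only [Complex.ofReal_natCast]
  rw [← norm_sq_groupSum, Complex.norm_real, Real.norm_eq_abs, sq_abs]
  ring

/-- `‖groupSum t b‖` is constant on the coset of `b`; averaging the expansion over that coset turns
each character into a group sum. -/
theorem card_mul_norm_sq_groupSum {t : ℕ} (ht : 0 < t) (b : ZMod p) :
    (((unityRoots p t).card * ‖groupSum t b‖ ^ 2 : ℝ) : ℂ)
      = ∑ l : ZMod p, (diffCount t l : ℂ) * groupSum t (b * l) := by
  have h : (((unityRoots p t).card * ‖groupSum t b‖ ^ 2 : ℝ) : ℂ)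
      = ∑ h ∈ unityRoots p t, ((‖groupSum t (b * h)‖ ^ 2 : ℝ) : ℂ) := by
    rw [Finset.sum_congr rfl fun h hh => by rw [groupSum_mul ht hh], Finset.sum_const,
      nsmul_eq_mul]
    push_cast
    rfl
  rw [h]
  simp only [norm_sq_groupSum]
  rw [Finset.sum_comm]
  refine Finset.sum_congr rfl fun l _ => ?_
  rw [← Finset.mul_sum, groupSum]
  simp only [mul_right_comm, mul_assoc]

/-- Parseval counts the same value once for each element of the coset of `b`. -/
theorem norm_groupSum_sq_le {t : ℕ} (ht : 0 < t) {b : ZMod p} (hb : b ≠ 0) :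
    ‖groupSum t b‖ ^ 2 ≤ p := by
  have hpos : (0 : ℝ) < (unityRoots p t).card := by
    exact_mod_cast Finset.card_pos.2 ⟨1, by simp [mem_unityRoots]⟩
  refine le_of_mul_le_mul_left ?_ hpos
  rw [mul_comm _ (p : ℝ), ← sum_norm_sq_groupSum]
  calc ((unityRoots p t).card : ℝ) * ‖groupSum t b‖ ^ 2
      = ∑ h ∈ unityRoots p t, ‖groupSum t (b * h)‖ ^ 2 := by
        rw [Finset.sum_congr rfl fun h hh => by rw [groupSum_mul ht hh], Finset.sum_const,
          nsmul_eq_mul]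
    _ = ∑ c ∈ (unityRoots p t).image (b * ·), ‖groupSum t c‖ ^ 2 := by
        rw [Finset.sum_image fun x _ y _ h => mul_left_cancel₀ hb h]
    _ ≤ _ := Finset.sum_le_sum_of_subset_of_nonneg (Finset.subset_univ _) fun _ _ _ => by positivity

/-- Cauchy–Schwarz is applied twice to the averaged identity: first with total weight `N ^ 2`, then
against the fourth moment, which is `p` times the energy. -/
theorem norm_groupSum_pow_eight_le {t : ℕ} (ht : 0 < t) {b : ZMod p} (hb : b ≠ 0) :
    ‖groupSum t b‖ ^ 8 ≤ p * (∑ l : ZMod p, (diffCount t l : ℝ) ^ 2) ^ 2 := by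
  set N : ℝ := ((unityRoots p t).card : ℝ) with hN
  set E : ℝ := ∑ l : ZMod p, (diffCount t l : ℝ) ^ 2 with hE
  have hpos : 0 < N := by
    rw [hN]
    exact_mod_cast Finset.card_pos.2 ⟨1, by simp [mem_unityRoots]⟩
  set U : ℝ := ∑ l : ZMod p, (diffCount t l : ℝ) * ‖groupSum t (b * l)‖ ^ 2 with hU
  have h1 : N * ‖groupSum t b‖ ^ 2 ≤ ∑ l : ZMod p, (diffCount t l : ℝ) * ‖groupSum t (b * l)‖ := by
    have h := congrArg norm (card_mul_norm_sq_groupSum ht b)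
    rw [Complex.norm_real, Real.norm_of_nonneg (by positivity)] at h
    rw [hN, h]
    refine (norm_sum_le _ _).trans_eq (Finset.sum_congr rfl fun l _ => ?_)
    rw [norm_mul, Complex.norm_natCast]
  have h2 : (∑ l : ZMod p, (diffCount t l : ℝ) * ‖groupSum t (b * l)‖) ^ 2 ≤ N ^ 2 * U := by
    have hs : ∑ l : ZMod p, (diffCount t l : ℝ) = N ^ 2 := by
      rw [hN]; exact_mod_cast sum_diffCount (p := p) t
    rw [← hs]
    refine Finset.sum_sq_le_sum_mul_sum_of_sq_le_mul _ (fun _ _ => by positivity)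
      (fun _ _ => by positivity) fun l _ => le_of_eq (by ring)
  have h3 : U ^ 2 ≤ E * (p * E) := by
    have h4 : ∑ l : ZMod p, (‖groupSum t (b * l)‖ ^ 2) ^ 2 = p * E := by
      rw [hE, ← sum_norm_pow_four_groupSum]
      rw [← Equiv.sum_comp (Equiv.mulLeft₀ b hb) fun l => ‖groupSum t l‖ ^ 4]
      refine Finset.sum_congr rfl fun l _ => ?_
      rw [Equiv.mulLeft₀_apply]
      ring
    rw [← h4]
    exact Finset.sum_mul_sq_le_sq_mul_sq _ _ _
  have h5 : ‖groupSum t b‖ ^ 4 ≤ U := by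
    refine le_of_mul_le_mul_left ?_ (pow_pos hpos 2)
    calc N ^ 2 * ‖groupSum t b‖ ^ 4 = (N * ‖groupSum t b‖ ^ 2) ^ 2 := by ring
      _ ≤ _ := pow_le_pow_left₀ (by positivity) h1 2
      _ ≤ _ := h2
  calc ‖groupSum t b‖ ^ 8 = (‖groupSum t b‖ ^ 4) ^ 2 := by ring
    _ ≤ U ^ 2 := pow_le_pow_left₀ (by positivity) h5 2
    _ ≤ _ := h3
    _ = _ := by ring

theorem diffCount_le_of_mul_le {t A B : ℕ} {l : ZMod p} (hl : l ≠ 0) (ht : 0 < t)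
    (hB : 2 * A ≤ B ^ 2) (hA : 0 < A) (hAB : A * B ≤ t) (hBt : B * t ≤ p) :
    A * diffCount t l ≤ A - 1 + 2 * ((B - 1) * t) := by
  refine mul_card_le_of_pow_eq_one p hl ht hB hA hAB hBt _ fun x hx => ?_
  rw [Finset.mem_filter, mem_unityRoots, mem_unityRoots] at hx
  exact hx

theorem sum_diffCount_sq_le {t : ℕ} {M : ℝ} (hM : ∀ l : ZMod p, l ≠ 0 → (diffCount t l : ℝ) ≤ M) :
    ∑ l : ZMod p, (diffCount t l : ℝ) ^ 2 ≤
      (unityRoots p t).card ^ 2 + M * ((unityRoots p t).card ^ 2 - (unityRoots p t).card) := by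
  have hs : ∑ l : ZMod p, (diffCount t l : ℝ) = (unityRoots p t).card ^ 2 := by
    exact_mod_cast sum_diffCount (p := p) t
  rw [← Finset.add_sum_erase _ _ (Finset.mem_univ 0), diffCount_zero] at hs
  rw [← Finset.add_sum_erase _ _ (Finset.mem_univ 0), diffCount_zero]
  rw [← hs, add_sub_cancel_left, hs, Finset.mul_sum]
  gcongr with l hl
  rw [sq]
  exact mul_le_mul_of_nonneg_right (hM l (Finset.ne_of_mem_erase hl)) (by positivity)

/-- If the real parts of all nontrivial sums stay below `N - D`, so do, up to a factor of two,
their absolute values. -/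
theorem norm_groupSum_sq_le_of_re_le {t : ℕ} (ht : 0 < t) {D : ℝ}
    (hD : ∀ b : ZMod p, b ≠ 0 → (groupSum t b).re ≤ (unityRoots p t).card - D)
    {b : ZMod p} (hb : b ≠ 0) :
    ‖groupSum t b‖ ^ 2 ≤ (unityRoots p t).card ^ 2 - ((unityRoots p t).card - 1) * D := by
  set N : ℝ := ((unityRoots p t).card : ℝ) with hN
  have hpos : 0 < N := by
    rw [hN]
    exact_mod_cast Finset.card_pos.2 ⟨1, by simp [mem_unityRoots]⟩
  have hs : ∑ l : ZMod p, (diffCount t l : ℝ) = N ^ 2 := by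
    rw [hN]; exact_mod_cast sum_diffCount (p := p) t
  rw [← Finset.add_sum_erase _ _ (Finset.mem_univ 0), diffCount_zero, ← hN] at hs
  have h := congrArg Complex.re (card_mul_norm_sq_groupSum ht b)
  rw [Complex.ofReal_re, Complex.re_sum, ← Finset.add_sum_erase _ _ (Finset.mem_univ 0),
    diffCount_zero, ← hN] at h
  have h0 : groupSum t (b * 0) = ((N : ℝ) : ℂ) := by
    simp [groupSum, hN]
  -- The term `l = 0` gives `N ^ 2`; the others have total weight `N ^ 2 - N`, each with real part
  -- at most `N - D`.
  have h1 : ∑ l ∈ Finset.univ.erase (0 : ZMod p), ((diffCount t l : ℂ) * groupSum t (b * l)).re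
      ≤ ∑ l ∈ Finset.univ.erase (0 : ZMod p), (diffCount t l : ℝ) * (N - D) := by
    refine Finset.sum_le_sum fun l hl => ?_
    rw [← Complex.ofReal_natCast, Complex.re_ofReal_mul]
    exact mul_le_mul_of_nonneg_left (hD _ (mul_ne_zero hb (Finset.ne_of_mem_erase hl)))
      (by positivity)
  have h2 : (((unityRoots p t).card : ℂ) * groupSum t (b * 0)).re = N * N := by
    rw [h0, hN, ← Complex.ofReal_natCast, Complex.re_ofReal_mul, Complex.ofReal_re]
  rw [h2] at h
  rw [← Finset.sum_mul, show ∑ l ∈ Finset.univ.erase (0 : ZMod p), (diffCount t l : ℝ) = N ^ 2 - N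
    by linarith] at h1
  refine le_of_mul_le_mul_left ?_ hpos
  rw [h]
  nlinarith

/-- This is `cos u ≤ 1 - 2 u ^ 2 / π ^ 2` for `|u| ≤ π`, at `u = 2π * bracket c / p`. -/
theorem re_stdAddChar_le (c : ZMod p) :
    (ZMod.stdAddChar c : ℂ).re ≤ 1 - 8 / (p : ℝ) ^ 2 * (bracket c : ℝ) ^ 2 := by
  have hp : (0 : ℝ) < p := by exact_mod_cast (Fact.out : p.Prime).pos
  have h1 : (ZMod.stdAddChar c : ℂ) = Complex.exp (2 * Real.pi * Complex.I * (bracket c : ℤ) / p) := by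
    rw [← ZMod.stdAddChar_coe, bracket, ZMod.coe_valMinAbs]
  have h2 : (2 * Real.pi * Complex.I * (bracket c : ℤ) / p : ℂ)
      = ((2 * Real.pi * bracket c / p : ℝ) : ℂ) * Complex.I := by
    push_cast; ring
  rw [h1, h2, Complex.exp_ofReal_mul_I_re]
  have hb : |(bracket c : ℝ)| ≤ p / 2 := by
    have h := ZMod.natAbs_valMinAbs_le c
    have h' : (bracket c).natAbs * 2 ≤ p := by unfold bracket; omega
    rw [← Int.cast_abs, Int.abs_eq_natAbs, le_div_iff₀ two_pos]
    exact_mod_cast h'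
  have h3 : |2 * Real.pi * bracket c / p| ≤ Real.pi := by
    rw [abs_div, abs_mul, abs_of_pos Real.two_pi_pos, abs_of_pos hp, div_le_iff₀ hp]
    nlinarith [Real.pi_pos]
  refine (Real.cos_le_one_sub_mul_cos_sq h3).trans_eq ?_
  field_simp
  ring

theorem re_groupSum_le (t : ℕ) (b : ZMod p) :
    (groupSum t b).re ≤ (unityRoots p t).card
      - 8 / (p : ℝ) ^ 2 * ∑ x ∈ unityRoots p t, (bracket (b * x) : ℝ) ^ 2 := by
  rw [groupSum, Complex.re_sum]
  refine (Finset.sum_le_sum fun x _ => re_stdAddChar_le (b * x)).trans_eq ?_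
  rw [Finset.sum_sub_distrib, ← Finset.mul_sum, Finset.sum_const, nsmul_eq_mul, mul_one]

/-! ### Cosets through a generator, and reduction of the Gauss sum to a group sum -/

section Generator

variable {d t : ℕ} {g : (ZMod p)ˣ}

theorem orderOf_generator (hg : ∀ u : (ZMod p)ˣ, u ∈ Subgroup.zpowers g) : orderOf g = p - 1 := by
  rw [orderOf_eq_card_of_forall_mem_zpowers hg, Nat.card_eq_fintype_card, ZMod.card_units]

theorem unityRoots_eq_image (hg : ∀ u : (ZMod p)ˣ, u ∈ Subgroup.zpowers g) (hdt : d * t = p - 1) :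
    unityRoots p t = (Finset.Icc 1 t).image (fun x => (g : ZMod p) ^ (d * x)) ∧
      (unityRoots p t).card = t := by
  have hp := (Fact.out : p.Prime).two_le
  have hd : 0 < d := Nat.pos_of_ne_zero fun h => by subst h; omega
  have ht : 0 < t := Nat.pos_of_ne_zero fun h => by subst h; omega
  have hord : orderOf (g ^ d) = t := by
    rw [orderOf_pow_of_dvd hd.ne' (by rw [orderOf_generator hg]; exact ⟨t, hdt.symm⟩),
      orderOf_generator hg, ← hdt, Nat.mul_div_cancel_left t hd]
  have hinj : Set.InjOn (fun x => (g : ZMod p) ^ (d * x)) (Finset.Icc 1 t : Finset ℕ) := by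
    intro x hx y hy hxy
    rw [Finset.coe_Icc, Set.mem_Icc] at hx hy
    have h : (g ^ d) ^ x = (g ^ d) ^ y := by
      apply Units.ext
      simpa [pow_mul] using hxy
    rw [pow_eq_pow_iff_modEq, hord] at h
    rcases le_total x y with hle | hle
    · have := Nat.eq_zero_of_dvd_of_lt ((Nat.modEq_iff_dvd' hle).1 h) (by omega)
      omega
    · have := Nat.eq_zero_of_dvd_of_lt ((Nat.modEq_iff_dvd' hle).1 h.symm) (by omega)
      omega
  have hcard : ((Finset.Icc 1 t).image (fun x => (g : ZMod p) ^ (d * x))).card = t := by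
    rw [Finset.card_image_of_injOn hinj, Nat.card_Icc, Nat.add_sub_cancel]
  have hsub : (Finset.Icc 1 t).image (fun x => (g : ZMod p) ^ (d * x)) ⊆ unityRoots p t := by
    intro y hy
    obtain ⟨x, -, rfl⟩ := Finset.mem_image.1 hy
    rw [mem_unityRoots, ← pow_mul, mul_right_comm, hdt,
      pow_mul, ZMod.pow_card_sub_one_eq_one g.ne_zero, one_pow]
  have hle : (unityRoots p t).card ≤ t := by
    have h : unityRoots p t ⊆ Polynomial.nthRootsFinset t (1 : ZMod p) := fun x hx =>
      (Polynomial.mem_nthRootsFinset ht 1).2 (mem_unityRoots.1 hx)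
    refine (Finset.card_le_card h).trans ?_
    rw [Polynomial.nthRootsFinset_def]
    exact (Multiset.toFinset_card_le _).trans (Polynomial.card_nthRoots t 1)
  have heq := Finset.eq_of_subset_of_card_le hsub (by rw [hcard]; exact hle)
  exact ⟨heq.symm, by rw [← heq, hcard]⟩

theorem sum_unityRoots_eq {M : Type*} [AddCommMonoid M]
    (hg : ∀ u : (ZMod p)ˣ, u ∈ Subgroup.zpowers g) (hdt : d * t = p - 1) (f : ZMod p → M) :
    ∑ x ∈ unityRoots p t, f x = ∑ x ∈ Finset.Icc 1 t, f ((g : ZMod p) ^ (d * x)) := by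
  obtain ⟨h1, h2⟩ := unityRoots_eq_image hg hdt
  rw [h1, Finset.card_image_iff.1 _ |> Finset.sum_image]
  rw [← h1, h2, Nat.card_Icc, Nat.add_sub_cancel]

theorem exists_sum_coset_eq (hg : ∀ u : (ZMod p)ˣ, u ∈ Subgroup.zpowers g) (hdt : d * t = p - 1)
    (f : ZMod p → ℝ) {b : ZMod p} (hb : b ≠ 0) : ∃ y ∈ Finset.Icc 1 d,
      ∑ x ∈ unityRoots p t, f (b * x) = ∑ x ∈ Finset.Icc 1 t, f ((g : ZMod p) ^ (d * x + y)) := by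
  have hp := (Fact.out : p.Prime).two_le
  have hd : 0 < d := Nat.pos_of_ne_zero fun h => by subst h; omega
  have ht : 0 < t := Nat.pos_of_ne_zero fun h => by subst h; omega
  -- Writing `b = g ^ (m + 1)` places the coset index `m % d + 1` in `1, ..., d`.
  obtain ⟨m, hm⟩ : ∃ m : ℕ, g ^ m = Units.mk0 b hb * g⁻¹ :=
    (isOfFinOrder_of_finite g).mem_powers_iff_mem_zpowers.2 (hg _)
  have hbm : b = (g : ZMod p) ^ (d * (m / d)) * (g : ZMod p) ^ (m % d + 1) := by
    have h : Units.mk0 b hb = g ^ (m + 1) := by rw [pow_succ, hm, inv_mul_cancel_right]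
    have h' := congrArg Units.val h
    rw [Units.val_mk0, Units.val_pow_eq_pow_val] at h'
    rw [h', ← pow_add, ← add_assoc, Nat.div_add_mod]
  refine ⟨m % d + 1, Finset.mem_Icc.2 ⟨by omega, Nat.mod_lt m hd⟩, ?_⟩
  have hmem : (g : ZMod p) ^ (d * (m / d)) ∈ unityRoots p t := by
    rw [mem_unityRoots, ← pow_mul, mul_right_comm, hdt, pow_mul,
      ZMod.pow_card_sub_one_eq_one g.ne_zero, one_pow]
  calc ∑ x ∈ unityRoots p t, f (b * x)
      = ∑ x ∈ unityRoots p t,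
          f ((g : ZMod p) ^ (m % d + 1) * ((g : ZMod p) ^ (d * (m / d)) * x)) := by
        refine Finset.sum_congr rfl fun x _ => ?_
        rw [hbm]; congr 1; ring
    _ = ∑ x ∈ unityRoots p t, f ((g : ZMod p) ^ (m % d + 1) * x) :=
        sum_unityRoots_mul ht hmem fun x => f ((g : ZMod p) ^ (m % d + 1) * x)
    _ = _ := by
        rw [sum_unityRoots_eq hg hdt]
        refine Finset.sum_congr rfl fun x _ => ?_
        rw [pow_add (g : ZMod p) (d * x), mul_comm]

theorem sum_range_mul_of_periodic {M : Type*} [AddCommMonoid M] (t n : ℕ) (f : ℕ → M)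
    (hf : ∀ k, f (k + t) = f k) :
    ∑ k ∈ Finset.range (n * t), f k = n • ∑ k ∈ Finset.range t, f k := by
  induction n with
  | zero => simp
  | succ n ih =>
    have h : ∀ m k, f (m * t + k) = f k := by
      intro m k
      induction m with
      | zero => simp
      | succ m ihm => rw [← ihm, ← hf (m * t + k)]; congr 1; ring
    rw [Nat.succ_mul, Finset.sum_range_add, ih, succ_nsmul]
    simp only [h]

theorem sum_range_eq_sum_Icc {M : Type*} [AddCommMonoid M] (t : ℕ) (f : ℕ → M)
    (hf : f t = f 0) : ∑ k ∈ Finset.range t, f k = ∑ k ∈ Finset.Icc 1 t, f k := by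
  rw [Finset.range_eq_Ico, ← Finset.Ico_add_one_right_eq_Icc]
  rcases t with _ | t
  · simp
  · rw [Finset.sum_eq_sum_Ico_succ_bot (Nat.succ_pos t),
      Finset.sum_Ico_succ_top (by omega : 1 ≤ t + 1), hf, zero_add, add_comm]

theorem S_eq_groupSum (hg : ∀ u : (ZMod p)ˣ, u ∈ Subgroup.zpowers g) (hdt : d * t = p - 1)
    (a : ℤ) : S d a p = 1 + d * groupSum t (a : ZMod p) := by
  have hp := (Fact.out : p.Prime).two_le
  have hp0 : (p : ℂ) ≠ 0 := by exact_mod_cast (Fact.out : p.Prime).ne_zero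
  have hd : 0 < d := Nat.pos_of_ne_zero fun h => by subst h; omega
  have h1 : S d a p = ∑ x : ZMod p, (ZMod.stdAddChar ((a : ZMod p) * x ^ d) : ℂ) := by
    rw [S]
    refine Finset.sum_bij' (fun x _ => (x : ZMod p)) (fun x _ => x.val) ?_ ?_ ?_ ?_ ?_
    · simp
    · intro x _; exact Finset.mem_range.2 (ZMod.val_lt x)
    · intro x hx; exact ZMod.val_cast_of_lt (Finset.mem_range.1 hx)
    · intro x _; exact ZMod.natCast_zmod_val x
    · intro x _
      have : ((a : ZMod p) * (x : ZMod p) ^ d) = ((a * (x : ℤ) ^ d : ℤ) : ZMod p) := by push_cast; rfl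
      rw [this, ZMod.stdAddChar_coe, e]
      congr 1
      push_cast
      ring
  have h2 : ∑ x ∈ Finset.univ.erase (0 : ZMod p), (ZMod.stdAddChar ((a : ZMod p) * x ^ d) : ℂ)
      = ∑ k ∈ Finset.range (p - 1), (ZMod.stdAddChar ((a : ZMod p) * (g : ZMod p) ^ (d * k)) : ℂ) := by
    have hset : Finset.univ.erase (0 : ZMod p)
        = unityRoots p (p - 1) := by
      ext x
      rw [Finset.mem_erase, mem_unityRoots]
      constructor
      · exact fun h => ZMod.pow_card_sub_one_eq_one h.1
      · intro h
        exact ⟨ne_zero_of_mem_unityRoots (t := p - 1) (by omega) (mem_unityRoots.2 h),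
          Finset.mem_univ _⟩
    rw [hset, sum_unityRoots_eq (d := 1) hg (one_mul _), sum_range_eq_sum_Icc]
    · refine Finset.sum_congr rfl fun k _ => ?_
      rw [one_mul, ← pow_mul, mul_comm k]
    · rw [mul_comm d, pow_mul, ZMod.pow_card_sub_one_eq_one g.ne_zero, mul_zero, one_pow, pow_zero]
  have hgt : (g : ZMod p) ^ (d * t) = 1 := by
    rw [hdt, ZMod.pow_card_sub_one_eq_one g.ne_zero]
  rw [h1, ← Finset.add_sum_erase _ _ (Finset.mem_univ 0), h2, ← hdt, sum_range_mul_of_periodic,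
    sum_range_eq_sum_Icc, nsmul_eq_mul, groupSum, sum_unityRoots_eq hg hdt, zero_pow hd.ne']
  · simp
  · rw [hgt, mul_zero, pow_zero]
  · intro k
    rw [mul_add, pow_add, hgt, mul_one]

end Generator

end CharacterSums

/-! ### Numerical inequalities for each range of `t` -/

section Estimates

/-- From `exp 1 * y ≤ exp y` with `y = c * log x`. -/
theorem mul_log_le_rpow {x : ℝ} (hx : 0 < x) (c : ℝ) : 2.718 * (c * Real.log x) ≤ x ^ c := by
  have h1 := Real.add_one_le_exp (c * Real.log x - 1)
  have h2 : Real.exp (c * Real.log x - 1) * Real.exp 1 = x ^ c := by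
    rw [← Real.exp_add, sub_add_cancel, Real.rpow_def_of_pos hx, mul_comm]
  have h3 := Real.exp_one_gt_d9
  have h4 := Real.exp_pos (c * Real.log x - 1)
  rw [← h2]
  nlinarith

theorem sub_mul_log_div_le_rpow {x : ℝ} (hx : 0 < x) (n : ℝ) :
    x - x * (Real.log x / n) ≤ x ^ (1 - 1 / n) := by
  have h1 := Real.add_one_le_exp (-(Real.log x / n))
  have h2 : x ^ (1 - 1 / n) = x * Real.exp (-(Real.log x / n)) := by
    rw [Real.rpow_sub hx, Real.rpow_one, Real.rpow_def_of_pos hx, Real.exp_neg, div_eq_mul_inv]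
    congr 3
    ring
  rw [h2]
  nlinarith

theorem le_sub_div_of_sq_le {T t c : ℝ} (ht : 0 < t) (hT : T ^ 2 ≤ t ^ 2 - c) :
    T ≤ t - c / (2 * t) := by
  have h0 : c ≤ t ^ 2 := by nlinarith [sq_nonneg T]
  have h1 : 2 * t * (c / (2 * t)) = c := by field_simp
  have h2 : 0 ≤ t - c / (2 * t) := by
    by_contra hcon
    nlinarith
  refine le_of_sq_le_sq ?_ h2
  nlinarith [sq_nonneg (c / (2 * t))]

/-- The range of small subgroups. Here `q = p ^ (1 / 72)` and `s = t ^ (1 / 9)`. -/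
theorem one_add_mul_le_of_small {p q s t d n T Δ : ℝ} (hp : 8000 ≤ p) (hq : 0 < q)
    (hqp : q ^ 72 = p) (hlog : 2.718 * (5 / 72 * Real.log p) ≤ q ^ 5) (hs : 0 < s)
    (hst : s ^ 9 = t) (ht : 11 ≤ t) (hd : 0 < d) (hdt : d * t = p - 1) (hdn : d ≤ n)
    (htq : t ≤ 3 * q ^ 27) (hΔ : Δ * q ^ 16 = 104 * s) (hT : T ^ 2 ≤ t ^ 2 - (t - 1) * Δ) :
    1 + d * T ≤ p - p * (Real.log p / n) := by
  have h17 : s ^ 17 ≤ 8 * q ^ 51 := by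
    refine le_of_pow_le_pow_left₀ (n := 9) (by norm_num) (by positivity) ?_
    calc (s ^ 17) ^ 9 = t ^ 17 := by rw [← hst]; ring
      _ ≤ (3 * q ^ 27) ^ 17 := pow_le_pow_left₀ (by linarith) htq 17
      _ = 3 ^ 17 * q ^ 459 := by ring
      _ ≤ 8 ^ 9 * q ^ 459 := by gcongr; norm_num
      _ = _ := by ring
  have hT' := le_sub_div_of_sq_le (by linarith : 0 < t) hT
  have hlog0 : 0 ≤ Real.log p := Real.log_nonneg (by linarith)
  -- The exponent `5` makes the powers of `q` below balance: `5 + 16 + 51 = 72`.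
  have hlog' : Real.log p ≤ 5.3 * q ^ 5 := by nlinarith [pow_pos hq 5]
  have hΔpos : 0 < Δ := by
    by_contra hcon
    nlinarith [pow_pos hq 16]
  have hkey : p * Real.log p ≤ d * (d * ((t - 1) * Δ / (2 * t))) := by
    -- `(t - 1) / (2t)` is at least `5/11` exactly because `t ≥ 11`.
    have e1 : 5 / 11 * Δ ≤ (t - 1) * Δ / (2 * t) := by
      rw [le_div_iff₀ (by linarith)]
      nlinarith
    have e2 : p * Real.log p ≤ d * (d * (5 / 11 * Δ)) := by
      refine le_of_mul_le_mul_right ?_ (by positivity : 0 < t ^ 2 * q ^ 16)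
      have h3 : d * (d * (5 / 11 * Δ)) * (t ^ 2 * q ^ 16) = 520 / 11 * (p - 1) ^ 2 * s := by
        rw [← hdt]; linear_combination 5 / 11 * d ^ 2 * t ^ 2 * hΔ
      have h4 : p * Real.log p * (t ^ 2 * q ^ 16) ≤ 42.4 * p ^ 2 * s := by
        calc p * Real.log p * (t ^ 2 * q ^ 16) ≤ p * (5.3 * q ^ 5) * (t ^ 2 * q ^ 16) := by
              gcongr
          _ = 5.3 * p * q ^ 21 * s * s ^ 17 := by rw [← hst]; ring
          _ ≤ 5.3 * p * q ^ 21 * s * (8 * q ^ 51) := by gcongr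
          _ = 42.4 * p * s * q ^ 72 := by ring
          _ = _ := by rw [hqp]; ring
      rw [h3]
      refine h4.trans (mul_le_mul_of_nonneg_right ?_ hs.le)
      nlinarith
    exact e2.trans (by gcongr)
  have hfin : p * (Real.log p / n) ≤ d * ((t - 1) * Δ / (2 * t)) := by
    have hn : 0 < n := hd.trans_le hdn
    rw [← mul_div_assoc, div_le_iff₀ hn]
    refine hkey.trans ?_
    rw [mul_comm d (d * _)]
    have : 0 ≤ d * ((t - 1) * Δ / (2 * t)) := by
      have : 0 ≤ t - 1 := by linarith
      positivity
    gcongr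
  have := mul_le_mul_of_nonneg_left hT' hd.le
  nlinarith

/-- The range of medium subgroups. Here `q = p ^ (1 / 72)` and `r = (2 * t) ^ (1 / 3)`. -/
theorem one_add_mul_le_of_medium {p q r t d n T : ℝ} (hp : 8000 ≤ p) (hq : 0 < q)
    (hqp : q ^ 72 = p) (hlog : 2.718 * (1 / 4 * Real.log p) ≤ q ^ 18) (hr : 0 < r)
    (hrt : r ^ 3 = 2 * t) (hd : 0 < d) (hdt : d * t = p - 1) (hdn : d ≤ n) (hn : 2000 ≤ n)
    (htq : 3 * q ^ 27 ≤ t) (htq' : t ≤ 2 * q ^ 36)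
    (hT : T ^ 8 ≤ p * (t ^ 2 * (2 + 2 * r ^ 2)) ^ 2) :
    1 + d * T ≤ p - p * (Real.log p / n) := by
  have hq9 : 3 ≤ q ^ 9 := by
    refine le_of_pow_le_pow_left₀ (n := 8) (by norm_num) (by positivity) ?_
    rw [← pow_mul, hqp]; linarith
  have hrq : 1.816 * q ^ 9 ≤ r := by
    refine le_of_pow_le_pow_left₀ (n := 3) (by norm_num) hr.le ?_
    rw [hrt, mul_pow, ← pow_mul]
    nlinarith [pow_pos hq 27]
  have hr5 : 5.448 ≤ r := by linarith
  have ht : 0 < t := by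
    have := pow_pos hq 27
    linarith
  have hr4 : 10.87 * q ^ 36 ≤ r ^ 4 := by
    calc 10.87 * q ^ 36 ≤ (1.816 * q ^ 9) ^ 4 := by
          rw [mul_pow, ← pow_mul]
          exact mul_le_mul_of_nonneg_right (by norm_num) (by positivity)
      _ ≤ _ := pow_le_pow_left₀ (by positivity) hrq 4
  have hr2 : 1 + r ^ 2 ≤ 1.034 * r ^ 2 := by nlinarith
  have hhalf : q ^ 36 * (2 + 2 * r ^ 2) ≤ 0.9 ^ 2 * t ^ 2 := by
    have e : t ^ 2 = r ^ 4 * r ^ 2 / 4 := by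
      have : t = r ^ 3 / 2 := by linarith
      rw [this]; ring
    rw [e]
    calc q ^ 36 * (2 + 2 * r ^ 2) ≤ (r ^ 4 * 0.0921) * (2 * (1.034 * r ^ 2)) := by
          gcongr
          · nlinarith [pow_pos hq 36]
          · linarith
      _ ≤ _ := by
          have : 0 < r ^ 4 * r ^ 2 := by positivity
          nlinarith
  have hT' : T ≤ 0.95 * t := by
    refine le_of_pow_le_pow_left₀ (n := 8) (by norm_num) (by positivity) (hT.trans ?_)
    calc p * (t ^ 2 * (2 + 2 * r ^ 2)) ^ 2 = t ^ 4 * (q ^ 36 * (2 + 2 * r ^ 2)) ^ 2 := by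
          rw [← hqp]; ring
      _ ≤ t ^ 4 * (0.9 ^ 2 * t ^ 2) ^ 2 := by gcongr
      _ ≤ (0.95 * t) ^ 8 := by
          have : 0 < t ^ 8 := by positivity
          nlinarith
  -- Here `d ≥ (p - 1) / (2 p ^ (1/2))`, so `n ≥ d` and `n ≥ 2000` bound `p ^ (1/2)` by `n ^ 2 /
  -- 999`.
  have hlogn : Real.log p ≤ 0.049 * n := by
    have e1 : 999 * q ^ 36 ≤ n ^ 2 := by
      have e2 : p - 1 ≤ d * (2 * q ^ 36) := by rw [← hdt]; gcongr
      have e3 : p = q ^ 36 * q ^ 36 := by rw [← hqp]; ring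
      have e4 : (q ^ 36 * 0.999) * q ^ 36 ≤ (2 * d) * q ^ 36 := by
        nlinarith
      have e5 := le_of_mul_le_mul_right e4 (by positivity)
      nlinarith
    have e6 : 31 * q ^ 18 ≤ n := by
      refine le_of_sq_le_sq ?_ (by linarith)
      have := pow_pos hq 36
      nlinarith
    nlinarith [pow_pos hq 18]
  have hdiv : Real.log p / n ≤ 0.049 := by
    rw [div_le_iff₀ (by linarith)]; exact hlogn
  have := mul_le_mul_of_nonneg_left hT' hd.le
  nlinarith

/-- The range of large subgroups. Here `q = p ^ (1 / 72)`. -/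
theorem one_add_mul_le_of_large {p q t d n T : ℝ} (hp : 8000 ≤ p) (hq : 0 < q)
    (hlog : 2.718 * (1 / 8 * Real.log p) ≤ q ^ 9)
    (hd : 0 < d) (hdt : d * t = p - 1) (hdn : d ≤ n) (hn : 2000 ≤ n)
    (hdq : q ^ 18 ≤ d) (htq : 2 * q ^ 36 ≤ t) (hT : T ≤ q ^ 36) :
    1 + d * T ≤ p - p * (Real.log p / n) := by
  have hlogn : Real.log p ≤ 0.1 * n := by
    have e6 : 40 * q ^ 9 ≤ n := by
      refine le_of_sq_le_sq ?_ (by linarith)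
      have := pow_pos hq 18
      nlinarith
    nlinarith [pow_pos hq 9]
  have hdiv : Real.log p / n ≤ 0.1 := by
    rw [div_le_iff₀ (by linarith)]; exact hlogn
  have h1 := mul_le_mul_of_nonneg_left hT hd.le
  have h2 := mul_le_mul_of_nonneg_left htq hd.le
  nlinarith

/-- A small `d` gives no lower bound for `n` in terms of `p`, so the logarithmic bound is of no use.
Instead `d * T ≤ p ^ (3/4)`, far below `p ^ (71/72)`. -/
theorem one_add_mul_le_rpow_of_index_small {p q d n T : ℝ} (hp : 8000 ≤ p) (hq : 0 < q)
    (hqp : q ^ 72 = p) (hqr : q = p ^ (1 / 72 : ℝ)) (hd : 0 < d) (hn : 2000 ≤ n) (hdq : d ≤ q ^ 18)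
    (hT : T ≤ q ^ 36) : 1 + d * T ≤ p ^ (1 - 1 / n) := by
  have hq1 : 1 ≤ q := by
    by_contra hcon
    have := pow_le_one₀ (n := 72) hq.le (not_le.1 hcon).le
    linarith
  have hq17 : 2 ≤ q ^ 17 := by
    refine le_of_pow_le_pow_left₀ (n := 5) (by norm_num) (by positivity) ?_
    calc (2 : ℝ) ^ 5 ≤ q ^ 72 := by rw [hqp]; linarith
      _ ≤ q ^ 85 := pow_le_pow_right₀ hq1 (by norm_num)
      _ = _ := by ring
  have h1 : d * T ≤ q ^ 54 := by
    calc d * T ≤ d * q ^ 36 := by gcongr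
      _ ≤ q ^ 18 * q ^ 36 := by gcongr
      _ = _ := by ring
  have h2 : q ^ 71 ≤ p ^ (1 - 1 / n) := by
    have : q ^ 71 = p ^ (71 / 72 : ℝ) := by
      rw [hqr, ← Real.rpow_mul_natCast (by linarith)]
      norm_num
    rw [this]
    refine Real.rpow_le_rpow_of_exponent_le (by linarith) ?_
    have : 1 / n ≤ 1 / 2000 := one_div_le_one_div_of_le (by norm_num) hn
    linarith
  have h3 : 1 ≤ q ^ 54 := one_le_pow₀ hq1
  have h4 : q ^ 71 = q ^ 54 * q ^ 17 := by ring
  nlinarith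

end Estimates

theorem diffCount_le {p : ℕ} [Fact p.Prime] {t : ℕ} {r : ℝ} (hr : 0 < r) (hrt : r ^ 3 = 2 * t)
    (ht : 4 ≤ t) (htp : 2 * t ^ 4 ≤ p ^ 3) {l : ZMod p} (hl : l ≠ 0) :
    (diffCount t l : ℝ) ≤ 1 + 2 * r ^ 2 := by
  -- Stepanov's parameters are `B = ⌊(2t) ^ (1/3)⌋` and `A = ⌊B ^ 2 / 2⌋`.
  obtain ⟨B, hB1, hB2⟩ : ∃ B : ℕ, B ^ 3 ≤ 2 * t ∧ 2 * t < (B + 1) ^ 3 := by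
    refine ⟨Nat.findGreatest (fun B => B ^ 3 ≤ 2 * t) (2 * t), ?_, ?_⟩
    · exact Nat.findGreatest_spec (P := fun B => B ^ 3 ≤ 2 * t) (m := 0) (by omega) (by simp)
    · by_contra hcon
      rw [not_lt] at hcon
      have hle := (Nat.le_self_pow (n := 3) (by norm_num) _).trans hcon
      have := Nat.le_findGreatest (P := fun B => B ^ 3 ≤ 2 * t) hle hcon
      omega
  have hB : 2 ≤ B := by
    by_contra hcon
    have : (B + 1) ^ 3 ≤ 2 ^ 3 := Nat.pow_le_pow_left (by omega) 3
    omega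
  obtain ⟨A, hA1, hA2⟩ : ∃ A : ℕ, 2 * A ≤ B ^ 2 ∧ B ^ 2 ≤ 2 * A + 1 := ⟨B ^ 2 / 2, by omega, by omega⟩
  have hA : 0 < A := by nlinarith
  have hAB : A * B ≤ t := by nlinarith
  have hBt : B * t ≤ p := by
    refine (Nat.pow_le_pow_iff_left (n := 3) (by norm_num)).1 ?_
    calc (B * t) ^ 3 = B ^ 3 * t ^ 3 := by ring
      _ ≤ 2 * t * t ^ 3 := Nat.mul_le_mul_right _ hB1
      _ = 2 * t ^ 4 := by ring
      _ ≤ p ^ 3 := htp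
  have h := diffCount_le_of_mul_le hl (by omega) hA1 hA hAB hBt
  have h' : (A : ℝ) * diffCount t l ≤ A - 1 + 2 * ((B - 1) * t) := by
    have := (Nat.cast_le (α := ℝ)).2 h
    push_cast [Nat.cast_sub (by omega : 1 ≤ A), Nat.cast_sub (by omega : 1 ≤ B)] at this
    exact this
  have hA' : (0 : ℝ) < A := by exact_mod_cast hA
  have hB' : (2 : ℝ) ≤ B := by exact_mod_cast hB
  have hA2' : (B : ℝ) ^ 2 ≤ 2 * A + 1 := by exact_mod_cast hA2
  have hrB : r ≤ B + 1 := by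
    refine le_of_pow_le_pow_left₀ (n := 3) (by norm_num) (by positivity) ?_
    rw [hrt]
    exact_mod_cast hB2.le
  refine le_of_mul_le_mul_left ?_ hA'
  -- `r ≤ B + 1`, and `B ^ 2 - 1 ≤ 2A`.
  have h1 : ((B : ℝ) - 1) * r ≤ 2 * A := by nlinarith
  have h2 : (B - 1 : ℝ) * r * r ^ 2 ≤ 2 * A * r ^ 2 := by gcongr
  have h3 : (B - 1 : ℝ) * r * r ^ 2 = (B - 1) * (2 * t) := by rw [← hrt]; ring
  nlinarith

end Stechkin

open Stechkin

/-! ### Assembly of the ranges -/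

theorem corollary3 (n p d t : ℕ) [Fact p.Prime]
    (hd : d = Nat.gcd n (p - 1)) (ht : t = (p - 1) / d)
    (g : (ZMod p)ˣ) (hg : ∀ u : (ZMod p)ˣ, u ∈ Subgroup.zpowers g)
    (hn : 2000 ≤ n) (hφ : 10 ≤ Nat.totient t) (hp : 8000 ≤ p)
    (hsum : ∀ y ∈ Finset.Icc 1 d,
      13 * (p : ℝ) ^ (16 / 9 : ℝ) * (t : ℝ) ^ (1 / 9 : ℝ) ≤
        ∑ x ∈ Finset.Icc 1 t, (Stechkin.bracket ((g : ZMod p) ^ (d * x + y)) : ℝ) ^ 2) :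
    Stechkin.G d p ≤ (p : ℝ) ^ (1 - 1 / (n : ℝ)) := by
  have hdt : d * t = p - 1 := by
    rw [ht]; exact Nat.mul_div_cancel' (hd ▸ Nat.gcd_dvd_right n (p - 1))
  have hdn : d ≤ n := hd ▸ Nat.gcd_le_left _ (by omega)
  have hd0 : 0 < d := Nat.pos_of_ne_zero fun h => by subst h; omega
  have ht11 : 11 ≤ t := by
    have : 1 < t := by
      by_contra hcon
      have := Nat.totient_le t
      omega
    have := Nat.totient_lt t this
    omega
  have ht0 : 0 < t := by omega
  obtain ⟨a, ha, hG⟩ := (isGreatest_G d p (by omega)).1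
  have ha0 : (a : ZMod p) ≠ 0 := by
    rw [Ne, ZMod.intCast_zmod_eq_zero_iff_dvd]
    intro hdvd
    have := Int.dvd_gcd hdvd (dvd_refl (p : ℤ))
    rw [ha] at this
    have := Nat.le_of_dvd one_pos this
    omega
  have hcard : (unityRoots p t).card = t := (unityRoots_eq_image hg hdt).2
  set T : ℝ := ‖groupSum t (a : ZMod p)‖ with hTdef
  have hT0 : 0 ≤ T := norm_nonneg _
  have hGT : G d p ≤ 1 + d * T := by
    rw [hG, S_eq_groupSum hg hdt]
    refine (norm_add_le _ _).trans ?_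
    rw [norm_one, norm_mul, Complex.norm_natCast]
  refine hGT.trans ?_
  have hpR : (8000 : ℝ) ≤ p := by exact_mod_cast hp
  have hp0 : (0 : ℝ) < p := by linarith
  have hnR : (2000 : ℝ) ≤ n := by exact_mod_cast hn
  have hdnR : (d : ℝ) ≤ n := by exact_mod_cast hdn
  have hd0R : (0 : ℝ) < d := by exact_mod_cast hd0
  have ht11R : (11 : ℝ) ≤ t := by exact_mod_cast ht11
  have hdtR : (d : ℝ) * t = p - 1 := by
    have h : ((d * t : ℕ) : ℝ) = ((p - 1 : ℕ) : ℝ) := by rw [hdt]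
    rwa [Nat.cast_mul, Nat.cast_sub (by omega), Nat.cast_one] at h
  -- All exponents of `p` in use (`1/4`, `3/8`, `1/2`, `16/9`, `5/72`) are multiples of `1/72`.
  obtain ⟨q, hq⟩ : ∃ q : ℝ, q = (p : ℝ) ^ (1 / 72 : ℝ) := ⟨_, rfl⟩
  have hq0 : 0 < q := by rw [hq]; positivity
  have hqpow : ∀ k : ℕ, q ^ k = (p : ℝ) ^ (k / 72 : ℝ) := by
    intro k
    rw [hq, ← Real.rpow_mul_natCast hp0.le]
    congr 1
    ring
  have hqp : q ^ 72 = p := by rw [hqpow]; norm_num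
  have hTsq : T ≤ q ^ 36 := by
    refine le_of_sq_le_sq ?_ (by positivity)
    rw [← pow_mul, hqp]
    exact norm_groupSum_sq_le ht0 ha0
  rcases le_total (2 * q ^ 36) (t : ℝ) with hlarge | hnlarge
  · rcases le_total (d : ℝ) (q ^ 18) with hds | hdl
    · exact one_add_mul_le_rpow_of_index_small hpR hq0 hqp hq hd0R hnR hds hTsq
    · refine le_trans ?_ (sub_mul_log_div_le_rpow hp0 n)
      refine one_add_mul_le_of_large hpR hq0 ?_ hd0R hdtR hdnR hnR hdl hlarge hTsq
      have := mul_log_le_rpow hp0 (1 / 8)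
      rw [hqpow]
      norm_num at this ⊢
      exact this
  refine le_trans ?_ (sub_mul_log_div_le_rpow hp0 n)
  rcases le_total (t : ℝ) (3 * q ^ 27) with hsmall | hmedium
  · obtain ⟨s, hs⟩ : ∃ s : ℝ, s = (t : ℝ) ^ (1 / 9 : ℝ) := ⟨_, rfl⟩
    have hs0 : 0 < s := by rw [hs]; positivity
    have hst : s ^ 9 = t := by
      rw [hs, ← Real.rpow_mul_natCast (by positivity)]; norm_num
    have hp16 : (p : ℝ) ^ (16 / 9 : ℝ) = q ^ 128 := by rw [hqpow]; norm_num
    -- Here `Δ = 104 s / q ^ 16`, from `8 * 13 = 104` and `p ^ 2 = q ^ 144`.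
    refine one_add_mul_le_of_small (Δ := 8 / (p : ℝ) ^ 2 * (13 * q ^ 128 * s)) hpR hq0 hqp ?_ hs0
      hst ht11R hd0R hdtR hdnR hsmall ?_ ?_
    · have := mul_log_le_rpow hp0 (5 / 72)
      rw [hqpow]
      exact this
    · rw [← hqp]
      field_simp
      norm_num
    · have h := norm_groupSum_sq_le_of_re_le ht0 (D := 8 / (p : ℝ) ^ 2 * (13 * q ^ 128 * s)) ?_ ha0
      · rwa [hcard] at h
      · intro b hb
        refine (re_groupSum_le t b).trans ?_
        obtain ⟨y, hy, heq⟩ := exists_sum_coset_eq hg hdt (fun c => (bracket c : ℝ) ^ 2) hb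
        have h := hsum y hy
        rw [← heq, hp16, ← hs] at h
        gcongr
  · obtain ⟨r, hr⟩ : ∃ r : ℝ, r = (2 * t : ℝ) ^ (1 / 3 : ℝ) := ⟨_, rfl⟩
    have hr0 : 0 < r := by rw [hr]; positivity
    have hrt : r ^ 3 = 2 * t := by
      rw [hr, ← Real.rpow_mul_natCast (by positivity)]; norm_num
    refine one_add_mul_le_of_medium hpR hq0 hqp ?_ hr0 hrt hd0R hdtR hdnR hnR hmedium hnlarge ?_
    · have := mul_log_le_rpow hp0 (1 / 4)
      rw [hqpow]
      norm_num at this ⊢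
      exact this
    have htp : 2 * t ^ 4 ≤ p ^ 3 := by
      have h : (2 * (t : ℝ) ^ 4) ≤ p ^ 3 := by
        calc 2 * (t : ℝ) ^ 4 ≤ 2 * (2 * q ^ 36) ^ 4 := by gcongr
          _ = 32 * (q ^ 72) ^ 2 := by ring
          _ = 32 * (p : ℝ) ^ 2 := by rw [hqp]
          _ ≤ (p : ℝ) * p ^ 2 := by gcongr; linarith
          _ = _ := by ring
      exact_mod_cast h
    have hE := sum_diffCount_sq_le (p := p) (t := t) (M := 1 + 2 * r ^ 2)
      fun l hl => diffCount_le hr0 hrt (by omega) htp hl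
    rw [hcard] at hE
    refine (norm_groupSum_pow_eight_le ht0 ha0).trans ?_
    gcongr
    refine hE.trans ?_
    have : 0 ≤ (1 + 2 * r ^ 2) * (t : ℝ) := by positivity
    nlinarith
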